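/- Let $k,\Theta,\mu,\sigma,\rho,\delta,C,T$ be real numbers with $k\neq0$ and $\sigma\neq0$ (if $\rho=0$, the quotient $\frac{1-\delta}{\rho}$ is read as $0$ throughout). Put $$\lambda=-\frac{k\Theta}{\sigma^2}+\frac{(1-\delta)\mu}{\rho\sigma},\qquad \eta=\sqrt{\Big(\lambda+\frac12\Big)^2+\frac{2C}{\sigma^2}},\qquad \Psi(v,t)=\frac{2kv}{\sigma^2\big(e^{k(T-t)}-1\big)}\quad(v>0,\ t<T),$$ and let $M_{\kappa,\eta}(z)=e^{-z/2}z^{\eta+1/2}\sum_{n\ge0}\frac{(\eta-\kappa+\frac12)_n}{(1+2\eta)_n}\frac{z^n}{n!}$ ($z>0$) be Whittaker's function. Suppose that one of the following holds: (a) (power utility) $|\rho|\le1$ and, for some $\gamma<0$, $\delta=1+\rho^2\frac{\gamma}{1-\gamma}$ and $C=-\frac{\gamma}{1-\gamma}\frac{\mu^2}{2}\delta$; (b) (exponential utility) $|\rho|\le1$, $\delta=1-\rho^2$ and $C=\frac{\mu^2}{2}\delta$; (c) more generally, $\delta$ and $C$ are any real numbers with $\big(\lambda+\frac12\big)^2+\frac{2C}{\sigma^2}\ge0$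 and $\eta-\lambda+\frac12>0$. Then the function $$f(v,t)=\frac{\Gamma(\eta-\lambda+\frac12)}{\Gamma(2\eta+1)}\,e^{-\Psi(v,t)/2}\,\Psi(v,t)^{\lambda}\,M_{\lambda,\eta}(\Psi(v,t)),\qquad v>0,\ t<T,$$ is a classical solution of the terminal-value problem $$\frac{\sigma^2v}{2}f_{vv}+\Big(k\Theta-\frac{1-\delta}{\rho}\mu\sigma-kv\Big)f_v-\frac{C}{v}f+f_t=0\quad(v>0,\ t<T),\qquad f(v,T)=1\quad(v>0),$$ that is, $f$ is twice continuously differentiable on $(0,\infty)\times(-\infty,T)$, satisfies the equation there, and for every $v>0$ one has $f(v',t)\to1$ as $(v',t)\to(v,T)$ with $v'>0$, $t<T$. Moreover, $f$ and $M_{\lambda,\eta}(\Psi)$ do not vanish for $v>0$, $t<T$, and there $$\frac{f_v}{f}=\frac{\eta+\lambda+\frac12}{v}\,\frac{M_{1+\lambda,\eta}(\Psi(v,t))}{M_{\lambda,\eta}(\Psi(v,t))}.$$ -/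

import Mathlib

open Set Filter Topology

noncomputable section

/-- Kummer's confluent hypergeometric function
`₁F₁(a; b; z) = ∑ₙ (a)ₙ / (b)ₙ * zⁿ / n!`, with `(a)ₙ` the rising factorial
(the series converges for all `z` when `b` is not a nonpositive integer). -/
def kummerM (a b z : ℝ) : ℝ :=
  ∑' n : ℕ, (ascPochhammer ℝ n).eval a / (ascPochhammer ℝ n).eval b * (z ^ n / (n.factorial : ℝ))

/-- Whittaker's function
`M_{κ,μ}(z) = e^{-z/2} z^{μ+1/2} ₁F₁(μ - κ + 1/2; 1 + 2μ; z)`, for `z > 0`. -/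
def whittakerM (κ μ z : ℝ) : ℝ :=
  Real.exp (-z / 2) * z ^ (μ + 1 / 2) * kummerM (μ - κ + 1 / 2) (1 + 2 * μ) z

/-- `λ = -kΘ/σ² + (1-δ)μ/(ρσ)`. -/
def hestonLam (k Θ μ σ ρ δ : ℝ) : ℝ :=
  -(k * Θ / σ ^ 2) + (1 - δ) * μ / (ρ * σ)

/-- The radicand `(λ + 1/2)² + 2C/σ²`. -/
def hestonDisc (k Θ μ σ ρ δ C : ℝ) : ℝ :=
  (hestonLam k Θ μ σ ρ δ + 1 / 2) ^ 2 + 2 * C / σ ^ 2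

/-- `η = √((λ + 1/2)² + 2C/σ²)`. -/
def hestonEta (k Θ μ σ ρ δ C : ℝ) : ℝ :=
  √(hestonDisc k Θ μ σ ρ δ C)

/-- `Ψ(v,t) = 2kv / (σ² (e^{k(T-t)} - 1))`. -/
def hestonPsi (k σ T v t : ℝ) : ℝ :=
  2 * k * v / (σ ^ 2 * (Real.exp (k * (T - t)) - 1))

/-- `f(v,t) = Γ(η-λ+1/2)/Γ(2η+1) * e^{-Ψ/2} Ψ^λ M_{λ,η}(Ψ)`, for `v > 0`, `t < T`. -/
def hestonF (k Θ μ σ ρ δ C T v t : ℝ) : ℝ :=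
  Real.Gamma (hestonEta k Θ μ σ ρ δ C - hestonLam k Θ μ σ ρ δ + 1 / 2)
      / Real.Gamma (2 * hestonEta k Θ μ σ ρ δ C + 1)
    * Real.exp (-hestonPsi k σ T v t / 2)
    * hestonPsi k σ T v t ^ hestonLam k Θ μ σ ρ δ
    * whittakerM (hestonLam k Θ μ σ ρ δ) (hestonEta k Θ μ σ ρ δ C) (hestonPsi k σ T v t)

/-- `f` is a classical solution, on `v > 0`, `t < T`, of
`σ²v/2 f_vv + (kΘ - (1-δ)/ρ μσ - kv) f_v - C/v f + f_t = 0`, `f(v,T) = 1`.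
The terminal condition says that `f` extends continuously, by the value `1`, to `t = T`. -/
structure IsHestonSolution (k Θ μ σ ρ δ C T : ℝ) (f : ℝ → ℝ → ℝ) : Prop where
  smooth : ContDiffOn ℝ 2 (fun p : ℝ × ℝ => f p.1 p.2) (Ioi 0 ×ˢ Iio T)
  pde : ∀ v t : ℝ, 0 < v → t < T →
    σ ^ 2 * v / 2 * deriv (fun y => deriv (fun x => f x t) y) v
      + (k * Θ - (1 - δ) / ρ * μ * σ - k * v) * deriv (fun x => f x t) v
      - C / v * f v t + deriv (fun s => f v s) t = 0
  terminal : ∀ v : ℝ, 0 < v →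
    Tendsto (fun p : ℝ × ℝ => f p.1 p.2) (𝓝[Ioi 0 ×ˢ Iio T] (v, T)) (𝓝 1)

end

/-! With `a = η - λ + 1/2` and `b = 2η + 1`, the exponentials and powers in `f` combine to `f =
G(Ψ)`, where `G(z) = Γ(a)/Γ(b) e^{-z} z^{b-a} ₁F₁(a; b; z)` is `kummerRatio b a`.

The equation: the contiguous relations `mul_deriv_kummerM_eq_raise` and `mul_deriv_kummerM_eq_lower`
make `G` and its companion with `a - 1` inside `₁F₁` a closed first-order linear system. All
derivatives of `f` are therefore combinations of these two functions, and the equation becomes an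
algebraic identity. The logarithmic derivative is their quotient.

The terminal value: `Ψ → ∞` as `t → T`, so the claim is `G → 1` at infinity (`tendsto_kummerRatio`).
For `a = b + j` this follows from a recurrence in `a`; for real `a ≥ b`, from convexity of `G` in
`a`, inherited from log-convexity of `Γ`; for `0 < a < b`, from L'Hôpital's rule, which passes from
`a + 1` to `a`.

Nonvanishing: all terms of the series are nonnegative for `a, b > 0`, and the first is `1`. -/

/-! ### Kummer's series, its derivative and contiguous relations -/

/-- The coefficient `(a)ₙ / (b)ₙ` of `zⁿ / n!` in Kummer's function. -/
noncomputable def kummerCoeff (a b : ℝ) (n : ℕ) : ℝ :=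
  (ascPochhammer ℝ n).eval a / (ascPochhammer ℝ n).eval b

theorem ascPochhammer_succ_eval_left (n : ℕ) (a : ℝ) :
    (ascPochhammer ℝ (n + 1)).eval a = a * (ascPochhammer ℝ n).eval (a + 1) := by
  simp [ascPochhammer_succ_left]

theorem kummerCoeff_succ (a b : ℝ) (n : ℕ) :
    kummerCoeff a b (n + 1) = kummerCoeff a b n * ((a + n) / (b + n)) := by
  simp only [kummerCoeff, ascPochhammer_succ_eval, mul_div_mul_comm]

theorem kummerCoeff_succ_left (a b : ℝ) (n : ℕ) :
    kummerCoeff a b (n + 1) = a / b * kummerCoeff (a + 1) (b + 1) n := by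
  simp only [kummerCoeff, ascPochhammer_succ_eval_left, mul_div_mul_comm]

theorem mul_kummerCoeff_add_one (a b : ℝ) (n : ℕ) :
    a * kummerCoeff (a + 1) b n = (a + n) * kummerCoeff a b n := by
  have h := (ascPochhammer_succ_eval_left n a).symm.trans (ascPochhammer_succ_eval n a)
  simp only [kummerCoeff, mul_div_assoc']
  rw [h, mul_comm]

/-- Consecutive coefficients have ratio at most `|a| / b + 1` in absolute value. An exponential
series then dominates Kummer's series and its termwise derivative. -/
theorem abs_kummerCoeff_le (a : ℝ) {b : ℝ} (hb : 0 < b) (n : ℕ) :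
    |kummerCoeff a b n| ≤ (|a| / b + 1) ^ n := by
  induction n with
  | zero => simp [kummerCoeff]
  | succ n ih =>
    rw [kummerCoeff_succ, abs_mul, pow_succ]
    refine mul_le_mul ih ?_ (abs_nonneg _) (by positivity)
    have hn : (0 : ℝ) ≤ n := n.cast_nonneg
    rw [abs_div, abs_of_pos (by positivity : 0 < b + n)]
    calc |a + n| / (b + n) ≤ (|a| + n) / (b + n) := by
          gcongr
          exact (abs_add_le _ _).trans (by rw [Nat.abs_cast])
      _ = |a| / (b + n) + n / (b + n) := add_div _ _ _
      _ ≤ |a| / b + 1 := by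
          gcongr
          · linarith
          · exact div_le_one_of_le₀ (by linarith) (by positivity)

theorem hasSum_kummerM (a : ℝ) {b : ℝ} (hb : 0 < b) (z : ℝ) :
    HasSum (fun n : ℕ => kummerCoeff a b n * (z ^ n / (n.factorial : ℝ))) (kummerM a b z) := by
  have : Summable fun n : ℕ => kummerCoeff a b n * (z ^ n / (n.factorial : ℝ)) := by
    refine .of_norm_bounded (Real.summable_pow_div_factorial ((|a| / b + 1) * |z|)) fun n => ?_
    rw [Real.norm_eq_abs, abs_mul, abs_div, abs_pow, Nat.abs_cast, mul_pow, mul_div_assoc]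
    gcongr
    exact abs_kummerCoeff_le a hb n
  exact this.hasSum

theorem hasDerivAt_kummerM (a : ℝ) {b : ℝ} (hb : 0 < b) (z : ℝ) :
    HasDerivAt (kummerM a b) (a / b * kummerM (a + 1) (b + 1) z) z := by
  set K := |a| / b + 1
  set R := |z| + 1
  have hK : 0 ≤ K := by positivity
  have hR : 0 ≤ R := by positivity
  let u : ℕ → ℝ := fun n => K ^ n * (n * R ^ (n - 1) / n.factorial)
  have hterm (d x : ℝ) (n : ℕ) : d * (((n + 1 : ℕ) : ℝ) * x ^ (n + 1 - 1) / (n + 1).factorial)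
      = d * (x ^ n / n.factorial) := by
    rw [Nat.factorial_succ, Nat.add_sub_cancel]
    push_cast
    rw [mul_div_mul_left _ _ (by positivity)]
  have hu : Summable u := by
    rw [← summable_nat_add_iff 1]
    refine ((Real.summable_pow_div_factorial (K * R)).mul_left K).congr fun n => ?_
    simp only [u]
    rw [hterm, mul_pow, pow_succ]
    ring
  have hmem : z ∈ Metric.ball (0 : ℝ) R := by simp [R]
  have hd := hasDerivAt_tsum_of_isPreconnected
    (g := fun (n : ℕ) (y : ℝ) => kummerCoeff a b n * (y ^ n / (n.factorial : ℝ)))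
    (g' := fun (n : ℕ) (y : ℝ) => kummerCoeff a b n * (n * y ^ (n - 1) / (n.factorial : ℝ)))
    hu Metric.isOpen_ball (convex_ball (0 : ℝ) R).isPreconnected
    (fun n y _ => ((hasDerivAt_pow n y).div_const _).const_mul _)
    (fun n y hy => by
      rw [Real.norm_eq_abs, abs_mul, abs_div, abs_mul, abs_pow, Nat.abs_cast, Nat.abs_cast]
      have : |y| ≤ R := by simpa using (mem_ball_zero_iff.1 hy).le
      simp only [u]
      gcongr
      exact abs_kummerCoeff_le a hb n)
    hmem (hasSum_kummerM a hb z).summable hmem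
  refine hd.congr_deriv ?_
  have hs : HasSum (fun n : ℕ => kummerCoeff a b (n + 1) *
      (((n + 1 : ℕ) : ℝ) * z ^ (n + 1 - 1) / ((n + 1).factorial : ℝ)))
      (a / b * kummerM (a + 1) (b + 1) z) := by
    refine ((hasSum_kummerM (a + 1) (by linarith : 0 < b + 1) z).mul_left (a / b)).congr_fun
      fun n => ?_
    rw [hterm, kummerCoeff_succ_left]
    ring
  have hs' := (hasSum_nat_add_iff (f := fun n : ℕ => kummerCoeff a b n *
    (n * z ^ (n - 1) / (n.factorial : ℝ))) 1).1 hs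
  simpa using hs'.tsum_eq

theorem contDiff_kummerM (a : ℝ) {b : ℝ} (hb : 0 < b) (n : ℕ) :
    ContDiff ℝ n (kummerM a b) := by
  induction n generalizing a b with
  | zero =>
    exact contDiff_zero.2 (continuous_iff_continuousAt.2 fun z =>
      (hasDerivAt_kummerM a hb z).continuousAt)
  | succ n ih =>
    push_cast
    refine contDiff_succ_iff_deriv.2 ⟨fun z => (hasDerivAt_kummerM a hb z).differentiableAt,
      by simp, ?_⟩
    rw [funext fun z => (hasDerivAt_kummerM a hb z).deriv]
    exact contDiff_const.mul (ih (a + 1) (by linarith))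

/-- The operator `z d/dz` multiplies the `n`-th term by `n`, so the contiguous relations can be
checked coefficient by coefficient. -/
theorem hasSum_mul_deriv_kummerM (a : ℝ) {b : ℝ} (hb : 0 < b) (z : ℝ) :
    HasSum (fun n : ℕ => n * (kummerCoeff a b n * (z ^ n / (n.factorial : ℝ))))
      (z * deriv (kummerM a b) z) := by
  rw [(hasDerivAt_kummerM a hb z).deriv, ← hasSum_nat_add_iff' 1]
  simp only [Finset.range_one, Finset.sum_singleton, Nat.cast_zero, zero_mul, sub_zero]
  refine (((hasSum_kummerM (a + 1) (by linarith : 0 < b + 1) z).mul_left (a / b)).mul_left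
    z).congr_fun fun n => ?_
  rw [kummerCoeff_succ_left, Nat.factorial_succ]
  push_cast
  field_simp
  ring

/-- `z M'(a) = a (M(a + 1) - M(a))`. -/
theorem mul_deriv_kummerM_eq_raise (a : ℝ) {b : ℝ} (hb : 0 < b) (z : ℝ) :
    z * deriv (kummerM a b) z = a * (kummerM (a + 1) b z - kummerM a b z) := by
  refine (hasSum_mul_deriv_kummerM a hb z).unique
    ((((hasSum_kummerM (a + 1) hb z).sub (hasSum_kummerM a hb z)).mul_left a).congr_fun
      fun n => ?_)
  linear_combination -(z ^ n / (n.factorial : ℝ)) * mul_kummerCoeff_add_one a b n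

/-- `z M'(a) = (b - a) (M(a - 1) - M(a)) + z M(a)`. -/
theorem mul_deriv_kummerM_eq_lower (a : ℝ) {b : ℝ} (hb : 0 < b) (z : ℝ) :
    z * deriv (kummerM a b) z =
      (b - a) * (kummerM (a - 1) b z - kummerM a b z) + z * kummerM a b z := by
  have hz : HasSum (fun n : ℕ => n * (kummerCoeff a b (n - 1) * (z ^ n / (n.factorial : ℝ))))
      (z * kummerM a b z) := by
    rw [← hasSum_nat_add_iff' 1]
    simp only [Finset.range_one, Finset.sum_singleton, Nat.cast_zero, zero_mul, sub_zero]
    refine ((hasSum_kummerM a hb z).mul_left z).congr_fun fun n => ?_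
    rw [Nat.add_sub_cancel, Nat.factorial_succ]
    push_cast
    field_simp
    ring
  refine (hasSum_mul_deriv_kummerM a hb z).unique
    (((((hasSum_kummerM (a - 1) hb z).sub (hasSum_kummerM a hb z)).mul_left (b - a)).add
      hz).congr_fun fun n => ?_)
  cases n with
  | zero => simp [kummerCoeff]
  | succ n =>
    have hbn : b + n ≠ 0 := by positivity
    have h1 : kummerCoeff (a - 1) b (n + 1) = kummerCoeff a b n * ((a - 1) / (b + n)) := by
      simp only [kummerCoeff]
      rw [ascPochhammer_succ_eval_left, ascPochhammer_succ_eval, sub_add_cancel]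
      rw [mul_comm (a - 1), mul_div_mul_comm]
    rw [h1, kummerCoeff_succ, Nat.add_sub_cancel]
    push_cast
    field_simp
    ring

theorem kummerM_pos {a b z : ℝ} (ha : 0 < a) (hb : 0 < b) (hz : 0 ≤ z) : 0 < kummerM a b z := by
  have h (n : ℕ) : 0 ≤ kummerCoeff a b n * (z ^ n / (n.factorial : ℝ)) :=
    mul_nonneg (div_nonneg (ascPochhammer_pos n a ha).le (ascPochhammer_pos n b hb).le)
      (by positivity)
  refine lt_of_lt_of_le one_pos ?_
  have := sum_le_hasSum {0} (fun n _ => h n) (hasSum_kummerM a hb z)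
  simpa [kummerCoeff] using this

theorem kummerM_self {b : ℝ} (hb : 0 < b) (z : ℝ) : kummerM b b z = Real.exp z := by
  rw [Real.exp_eq_exp_ℝ]
  refine (hasSum_kummerM b hb z).unique ((NormedSpace.expSeries_div_hasSum_exp z).congr_fun
    fun n => ?_)
  rw [kummerCoeff, div_self (ascPochhammer_pos n b hb).ne', one_mul]

/-! ### Asymptotics at infinity -/

/-- L'Hôpital's rule at `∞` for quotients with divergent denominator. -/
theorem tendsto_div_atTop_of_deriv {G G' H H' : ℝ → ℝ} {l : ℝ}
    (hG : ∀ᶠ x in atTop, HasDerivAt G (G' x) x) (hH : ∀ᶠ x in atTop, HasDerivAt H (H' x) x)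
    (hH' : ∀ᶠ x in atTop, 0 < H' x) (hHtop : Tendsto H atTop atTop)
    (hl : Tendsto (fun x => G' x / H' x) atTop (𝓝 l)) :
    Tendsto (fun x => G x / H x) atTop (𝓝 l) := by
  rw [Metric.tendsto_nhds]
  intro ε hε
  obtain ⟨x₀, hx₀⟩ := eventually_atTop.1
    (hG.and (hH.and (hH'.and (Metric.tendsto_nhds.1 hl (ε / 2) (by positivity)))))
  -- Using `s = 1` and `s = -1` bounds `|G - l H|` by `ε/2 * H` plus a constant, and a large `H`
  -- absorbs the constant into a second `ε/2 * H`.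
  have hmono (s : ℝ) (hs : |s| = 1) :
      MonotoneOn (fun x => ε / 2 * H x + s * (G x - l * H x)) (Ici x₀) := by
    have hd : ∀ x ∈ Ici x₀, HasDerivAt (fun x => ε / 2 * H x + s * (G x - l * H x))
        (ε / 2 * H' x + s * (G' x - l * H' x)) x := fun x hx => by
      obtain ⟨h1, h2, -, -⟩ := hx₀ x hx
      exact (h2.const_mul _).add ((h1.sub (h2.const_mul l)).const_mul s)
    refine monotoneOn_of_deriv_nonneg (convex_Ici x₀)
      (fun x hx => (hd x hx).continuousAt.continuousWithinAt)
      (fun x hx => (hd x (interior_subset hx)).differentiableAt.differentiableWithinAt)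
      fun x hx => ?_
    rw [(hd x (interior_subset hx)).deriv]
    obtain ⟨-, -, h3, h4⟩ := hx₀ x (interior_subset hx)
    rw [Real.dist_eq, div_sub' h3.ne', abs_div, abs_of_pos h3, div_lt_iff₀ h3] at h4
    have h5 : |s * (G' x - l * H' x)| < ε / 2 * H' x := by
      rwa [abs_mul, hs, one_mul, mul_comm l]
    linarith [(abs_lt.1 h5).1]
  set A := |ε / 2 * H x₀ + 1 * (G x₀ - l * H x₀)| + |ε / 2 * H x₀ + -1 * (G x₀ - l * H x₀)|
  filter_upwards [hHtop.eventually_gt_atTop 0, hHtop.eventually_gt_atTop (A / (ε / 2)),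
    eventually_ge_atTop x₀] with x hx hxA hxx
  have m1 := hmono 1 (by simp) self_mem_Ici hxx hxx
  have m2 := hmono (-1) (by simp) self_mem_Ici hxx hxx
  simp only at m1 m2
  rw [div_lt_iff₀ (by positivity)] at hxA
  rw [Real.dist_eq, div_sub' hx.ne', abs_div, abs_of_pos hx, div_lt_iff₀ hx, abs_lt]
  have a1 := neg_abs_le (ε / 2 * H x₀ + 1 * (G x₀ - l * H x₀))
  have a2 := neg_abs_le (ε / 2 * H x₀ + -1 * (G x₀ - l * H x₀))
  have a3 := abs_nonneg (ε / 2 * H x₀ + 1 * (G x₀ - l * H x₀))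
  have a4 := abs_nonneg (ε / 2 * H x₀ + -1 * (G x₀ - l * H x₀))
  constructor <;> linarith

/-- Kummer's function normalised by its leading behaviour at infinity. -/
noncomputable def kummerRatio (b a z : ℝ) : ℝ :=
  Real.Gamma a / Real.Gamma b * (Real.exp (-z) * z ^ (b - a) * kummerM a b z)

theorem kummerRatio_self {b z : ℝ} (hb : 0 < b) : kummerRatio b b z = 1 := by
  rw [kummerRatio, kummerM_self hb, div_self (Real.Gamma_pos_of_pos hb).ne', sub_self,
    Real.rpow_zero, mul_one, one_mul, ← Real.exp_add, neg_add_cancel, Real.exp_zero]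

/-- Equate the two expressions for `z M'(a)`. The `a - 1` term is left unnormalised because `a - 1`
may be a pole of `Γ`; at `a = b` its factor `b - a` vanishes, which starts the induction on `j`. -/
theorem kummerRatio_succ {a b z : ℝ} (ha : a ≠ 0) (hb : 0 < b) (hz : 0 < z) :
    kummerRatio b (a + 1) z = (1 + (2 * a - b) / z) * kummerRatio b a z +
      (b - a) * Real.Gamma a / Real.Gamma b *
        (Real.exp (-z) * z ^ (b - a - 1) * kummerM (a - 1) b z) := by
  have h := (mul_deriv_kummerM_eq_raise a hb z).symm.trans (mul_deriv_kummerM_eq_lower a hb z)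
  have h1 : z ^ (b - a) = z ^ (b - a - 1) * z := by
    rw [← Real.rpow_add_one hz.ne', sub_add_cancel]
  rw [kummerRatio, kummerRatio, Real.Gamma_add_one ha, ← sub_sub, h1]
  have h2 : (1 + (2 * a - b) / z) * z = z + (2 * a - b) := by field_simp
  linear_combination (Real.Gamma a / Real.Gamma b * Real.exp (-z) * z ^ (b - a - 1)) * h -
    (Real.Gamma a / Real.Gamma b * Real.exp (-z) * z ^ (b - a - 1) * kummerM a b z) * h2

theorem kummerRatio_add_two {a b z : ℝ} (ha : 0 < a) (hb : 0 < b) (hz : 0 < z) :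
    kummerRatio b (a + 2) z = (1 + (2 * a + 2 - b) / z) * kummerRatio b (a + 1) z +
      (b - a - 1) * a / z ^ 2 * kummerRatio b a z := by
  have h1 : z ^ (b - a) = z ^ (b - (a + 1) - 1) * z ^ 2 := by
    rw [← Real.rpow_natCast z 2, ← Real.rpow_add hz]
    congr 1
    push_cast
    ring
  rw [show a + 2 = a + 1 + 1 by ring, kummerRatio_succ (by positivity) hb hz,
    add_sub_cancel_right, Real.Gamma_add_one ha.ne', kummerRatio, kummerRatio, h1]
  field_simp
  ring

theorem tendsto_one_add_const_div_atTop (c : ℝ) :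
    Tendsto (fun z : ℝ => 1 + c / z) atTop (𝓝 1) := by
  simpa using tendsto_const_nhds.add (tendsto_const_nhds.div_atTop (tendsto_id (α := ℝ)))

theorem tendsto_kummerRatio_add_nat {b : ℝ} (hb : 0 < b) (j : ℕ) :
    Tendsto (kummerRatio b (b + j)) atTop (𝓝 1) := by
  induction j using Nat.twoStepInduction with
  | zero =>
    simp only [Nat.cast_zero, add_zero]
    exact tendsto_const_nhds.congr fun z => (kummerRatio_self hb).symm
  | one =>
    refine (tendsto_one_add_const_div_atTop b).congr' ?_
    filter_upwards [eventually_gt_atTop 0] with z hz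
    rw [Nat.cast_one, kummerRatio_succ hb.ne' hb hz, kummerRatio_self hb]
    ring
  | more j h1 h2 =>
    have hlim := ((tendsto_one_add_const_div_atTop (2 * (b + j) + 2 - b)).mul h2).add
      (((tendsto_const_nhds (x := (b - (b + j) - 1) * (b + j))).div_atTop
        (tendsto_pow_atTop (α := ℝ) two_ne_zero)).mul h1)
    simp only [mul_one, add_zero] at hlim
    refine hlim.congr' ?_
    filter_upwards [eventually_gt_atTop 0] with z hz
    have := kummerRatio_add_two (a := b + j) (by positivity) hb hz
    push_cast
    rw [← add_assoc, ← add_assoc, this]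

/-- Since `Γ(a) (a)ₙ = Γ(a + n)`, the parameter `a` enters each term only through `Γ(a + n) z^(b -
a)`, which is log-convex in `a`; the other factors are nonnegative for `z > 0`. -/
theorem hasSum_kummerRatio {a b z : ℝ} (ha : 0 < a) (hb : 0 < b) :
    HasSum (fun n : ℕ => Real.Gamma (a + n) * z ^ (b - a) *
      (Real.exp (-z) / Real.Gamma b / (ascPochhammer ℝ n).eval b * (z ^ n / (n.factorial : ℝ))))
      (kummerRatio b a z) := by
  have hG (n : ℕ) : Real.Gamma (a + n) = Real.Gamma a * (ascPochhammer ℝ n).eval a := by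
    induction n with
    | zero => simp
    | succ n ih =>
      push_cast
      rw [← add_assoc, Real.Gamma_add_one (by positivity), ih, ascPochhammer_succ_eval]
      ring
  rw [kummerRatio, ← mul_assoc]
  refine ((hasSum_kummerM a hb z).mul_left _).congr_fun fun n => ?_
  rw [hG, kummerCoeff]
  ring

theorem Gamma_mul_rpow_convex {x y s t z c : ℝ} (hx : 0 < x) (hy : 0 < y) (hs : 0 ≤ s)
    (ht : 0 ≤ t) (hst : s + t = 1) (hz : 0 < z) :
    Real.Gamma (s * x + t * y) * z ^ (c - (s * x + t * y)) ≤
      s * (Real.Gamma x * z ^ (c - x)) + t * (Real.Gamma y * z ^ (c - y)) := by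
  rcases hs.eq_or_lt with rfl | hs
  · obtain rfl : t = 1 := by linarith
    simp
  rcases ht.eq_or_lt with rfl | ht
  · obtain rfl : s = 1 := by linarith
    simp
  have hGx := Real.Gamma_pos_of_pos hx
  have hGy := Real.Gamma_pos_of_pos hy
  refine le_trans ?_ (Real.geom_mean_le_arith_mean2_weighted hs.le ht.le
    (by positivity : 0 ≤ Real.Gamma x * z ^ (c - x))
    (by positivity : 0 ≤ Real.Gamma y * z ^ (c - y)) hst)
  have hpow : z ^ (c - (s * x + t * y)) = (z ^ (c - x)) ^ s * (z ^ (c - y)) ^ t := by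
    rw [← Real.rpow_mul hz.le, ← Real.rpow_mul hz.le, ← Real.rpow_add hz]
    congr 1
    linear_combination (-c) * hst
  rw [Real.mul_rpow hGx.le (by positivity), Real.mul_rpow hGy.le (by positivity), hpow]
  calc _ ≤ (Real.Gamma x ^ s * Real.Gamma y ^ t) * ((z ^ (c - x)) ^ s * (z ^ (c - y)) ^ t) := by
        gcongr
        exact Real.Gamma_mul_add_mul_le_rpow_Gamma_mul_rpow_Gamma hx hy hs ht hst
    _ = _ := by ring

theorem kummerRatio_convex {b x y s t z : ℝ} (hb : 0 < b) (hx : 0 < x) (hy : 0 < y)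
    (hs : 0 ≤ s) (ht : 0 ≤ t) (hst : s + t = 1) (hz : 0 < z) :
    kummerRatio b (s * x + t * y) z ≤ s * kummerRatio b x z + t * kummerRatio b y z := by
  have hxy : 0 < s * x + t * y := by
    rcases hs.eq_or_lt with rfl | hs
    · obtain rfl : t = 1 := by linarith
      simpa
    · positivity
  refine hasSum_le (fun n => ?_) (hasSum_kummerRatio hxy hb)
    (((hasSum_kummerRatio hx hb).mul_left s).add ((hasSum_kummerRatio hy hb).mul_left t))
  have hn : (0 : ℝ) ≤ n := n.cast_nonneg
  have h := Gamma_mul_rpow_convex (c := b + n) (by positivity : 0 < x + n)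
    (by positivity : 0 < y + n) hs ht hst hz
  rw [show s * (x + n) + t * (y + n) = s * x + t * y + n by linear_combination n * hst] at h
  simp only [add_sub_add_right_eq_sub] at h
  have hp := ascPochhammer_pos n b hb
  have hG := Real.Gamma_pos_of_pos hb
  have hc : 0 ≤ Real.exp (-z) / Real.Gamma b / (ascPochhammer ℝ n).eval b *
    (z ^ n / (n.factorial : ℝ)) := by positivity
  refine (mul_le_mul_of_nonneg_right h hc).trans_eq ?_
  ring

/-- With `a` in `[b + j, b + j + 1)`, convexity puts the value at `a` below the chord over that
interval and above the line through the values at `b + j + 1` and `b + j + 2`. Both bounds tend to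
`1`. -/
theorem tendsto_kummerRatio_of_le {a b : ℝ} (hb : 0 < b) (hab : b ≤ a) :
    Tendsto (kummerRatio b a) atTop (𝓝 1) := by
  set j := ⌊a - b⌋₊
  have hj : (j : ℝ) ≤ a - b := Nat.floor_le (by linarith)
  have hj' : a - b < j + 1 := Nat.lt_floor_add_one _
  have hj0 : (0 : ℝ) ≤ j := j.cast_nonneg
  set θ := a - b - j with hθ
  have h0 := tendsto_kummerRatio_add_nat hb j
  have h1 := tendsto_kummerRatio_add_nat hb (j + 1)
  have h2 := tendsto_kummerRatio_add_nat hb (j + 2)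
  push_cast at h1 h2
  have hup := (h0.const_mul (1 - θ)).add (h1.const_mul θ)
  have hlo := (h1.const_mul (2 - θ)).sub (h2.const_mul (1 - θ))
  rw [show (1 - θ) * 1 + θ * 1 = 1 by ring] at hup
  rw [show (2 - θ) * 1 - (1 - θ) * 1 = 1 by ring] at hlo
  have hθ2 : 0 < 2 - θ := by linarith
  refine tendsto_of_tendsto_of_tendsto_of_le_of_le' hlo hup ?_ ?_
  · filter_upwards [eventually_gt_atTop 0] with z hz
    -- The weights express `b + j + 1` as a convex combination of `a` and `b + j + 2`.
    have h := kummerRatio_convex (x := a) (y := b + (j + 2)) (s := 1 / (2 - θ))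
      (t := (1 - θ) / (2 - θ)) hb (by linarith) (by positivity) (by positivity)
      (div_nonneg (by linarith) hθ2.le) (by field_simp; ring) hz
    rw [show 1 / (2 - θ) * a + (1 - θ) / (2 - θ) * (b + (j + 2)) = b + (j + 1) by
      rw [show a = b + j + θ by rw [hθ]; ring]
      field_simp
      ring] at h
    have h' := mul_le_mul_of_nonneg_left h hθ2.le
    rw [show (2 - θ) * (1 / (2 - θ) * kummerRatio b a z + (1 - θ) / (2 - θ) *
      kummerRatio b (b + (j + 2)) z) = kummerRatio b a z + (1 - θ) *
      kummerRatio b (b + (j + 2)) z by field_simp] at h'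
    linarith
  · filter_upwards [eventually_gt_atTop 0] with z hz
    have h := kummerRatio_convex (x := b + j) (y := b + (j + 1)) (s := 1 - θ) (t := θ) hb
      (by positivity) (by positivity) (by linarith) (by linarith) (by ring) hz
    rwa [show (1 - θ) * (b + j) + θ * (b + (j + 1)) = a by rw [hθ]; ring] at h

theorem tendsto_rpow_mul_exp_atTop (c : ℝ) :
    Tendsto (fun z : ℝ => z ^ c * Real.exp z) atTop atTop := by
  refine (tendsto_exp_div_rpow_atTop (-c)).congr' ?_
  filter_upwards [eventually_gt_atTop 0] with z hz
  rw [Real.rpow_neg hz.le, div_inv_eq_mul, mul_comm]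

/-- By the raising relation, `Γ(a) z^a M(a)` has derivative `Γ(a + 1) z^(a - 1) M(a + 1)`.
L'Hôpital's rule compares it with the expected growth `z^(2a - b) e^z`. -/
theorem tendsto_kummerRatio_of_add_one {a b : ℝ} (ha : 0 < a) (hb : 0 < b)
    (h : Tendsto (kummerRatio b (a + 1)) atTop (𝓝 1)) :
    Tendsto (kummerRatio b a) atTop (𝓝 1) := by
  set c := 2 * a - b with hc
  set γ := Real.Gamma a / Real.Gamma b with hγ
  have hlim := tendsto_div_atTop_of_deriv (l := 1)
    (G := fun z => γ * (z ^ a * kummerM a b z))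
    (G' := fun z => kummerRatio b (a + 1) z * (z ^ c * Real.exp z))
    (H := fun z => z ^ c * Real.exp z)
    (H' := fun z => (1 + c / z) * (z ^ c * Real.exp z)) ?_ ?_ ?_
    (tendsto_rpow_mul_exp_atTop c) ?_
  · refine hlim.congr' ?_
    filter_upwards [eventually_gt_atTop 0] with z hz
    have h1 : z ^ a = z ^ (b - a) * z ^ c := by
      rw [← Real.rpow_add hz]
      congr 1
      rw [hc]
      ring
    rw [kummerRatio, h1, hγ, Real.exp_neg]
    field_simp
  · filter_upwards [eventually_gt_atTop 0] with z hz
    have hM := (hasDerivAt_kummerM a hb z).differentiableAt.hasDerivAt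
    refine (((Real.hasDerivAt_rpow_const (p := a) (Or.inl hz.ne')).mul hM).const_mul
      γ).congr_deriv ?_
    have hr := mul_deriv_kummerM_eq_raise a hb z
    have h1 : z ^ (b - (a + 1)) * z ^ c = z ^ (a - 1) := by
      rw [← Real.rpow_add hz]
      congr 1
      rw [hc]
      ring
    have h2 : z ^ a = z ^ (a - 1) * z := by rw [← Real.rpow_add_one hz.ne', sub_add_cancel]
    have h3 : Real.exp (-z) * Real.exp z = 1 := by rw [← Real.exp_add]; simp
    rw [kummerRatio, Real.Gamma_add_one ha.ne', h2, hγ]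
    linear_combination (Real.Gamma a / Real.Gamma b * z ^ (a - 1)) * hr -
      (Real.Gamma a / Real.Gamma b * a * kummerM (a + 1) b z * Real.exp (-z) *
        Real.exp z) * h1 - (Real.Gamma a / Real.Gamma b * a * kummerM (a + 1) b z *
        z ^ (a - 1)) * h3
  · filter_upwards [eventually_gt_atTop 0] with z hz
    refine ((Real.hasDerivAt_rpow_const (p := c) (Or.inl hz.ne')).mul
      (Real.hasDerivAt_exp z)).congr_deriv ?_
    rw [Real.rpow_sub_one hz.ne']
    field_simp
    ring
  · filter_upwards [eventually_gt_atTop 0,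
      (tendsto_one_add_const_div_atTop c).eventually_const_lt one_pos] with z hz hz1
    positivity
  · have := h.div (tendsto_one_add_const_div_atTop c) one_ne_zero
    rw [div_one] at this
    refine this.congr' ?_
    filter_upwards [eventually_gt_atTop 0] with z hz
    exact (mul_div_mul_right _ _ (by positivity)).symm

/-- `₁F₁(a; b; z) ∼ Γ(b) / Γ(a) * e^z z^(a - b)` as `z → ∞`, for `a, b > 0`. -/
theorem tendsto_kummerRatio {a b : ℝ} (ha : 0 < a) (hb : 0 < b) :
    Tendsto (kummerRatio b a) atTop (𝓝 1) := by
  obtain ⟨n, hn⟩ := exists_nat_ge (b - a)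
  induction n generalizing a with
  | zero => exact tendsto_kummerRatio_of_le hb (by simpa using hn)
  | succ n ih =>
    push_cast at hn
    exact tendsto_kummerRatio_of_add_one ha hb (ih (by linarith) (by linarith))

/-! ### The first-order system for the normalised function -/

theorem hasDerivAt_exp_neg_mul_rpow_mul_kummerM (a p : ℝ) {b z : ℝ} (hb : 0 < b) (hz : 0 < z) :
    HasDerivAt (fun z => Real.exp (-z) * z ^ p * kummerM a b z)
      (Real.exp (-z) * z ^ p * ((p - z) * kummerM a b z + z * deriv (kummerM a b) z) / z) z := by
  have hM := (hasDerivAt_kummerM a hb z).differentiableAt.hasDerivAt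
  refine (((hasDerivAt_neg z).exp.mul
    (Real.hasDerivAt_rpow_const (p := p) (Or.inl hz.ne'))).mul hM).congr_deriv ?_
  rw [Real.rpow_sub_one hz.ne', Pi.mul_apply]
  field_simp
  ring

/-- The companion of `kummerRatio` with first parameter of `₁F₁` lowered by one. -/
noncomputable def kummerRatioLower (b a z : ℝ) : ℝ :=
  Real.Gamma a / Real.Gamma b * (Real.exp (-z) * z ^ (b - a) * kummerM (a - 1) b z)

/-- The summand `z M(a)` of the lowering relation cancels the derivative of `e^{-z}`, so only `M(a -
1)` survives. -/
theorem hasDerivAt_kummerRatio (a : ℝ) {b z : ℝ} (hb : 0 < b) (hz : 0 < z) :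
    HasDerivAt (kummerRatio b a) ((b - a) * kummerRatioLower b a z / z) z := by
  refine ((hasDerivAt_exp_neg_mul_rpow_mul_kummerM a (b - a) hb hz).const_mul
    (Real.Gamma a / Real.Gamma b)).congr_deriv ?_
  rw [mul_deriv_kummerM_eq_lower a hb z, kummerRatioLower]
  ring

/-- Raising from `a - 1` returns to `M(a)`, which closes the system. -/
theorem hasDerivAt_kummerRatioLower (a : ℝ) {b z : ℝ} (hb : 0 < b) (hz : 0 < z) :
    HasDerivAt (kummerRatioLower b a) (((b - a - z) * kummerRatioLower b a z +
      (a - 1) * (kummerRatio b a z - kummerRatioLower b a z)) / z) z := by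
  refine ((hasDerivAt_exp_neg_mul_rpow_mul_kummerM (a - 1) (b - a) hb hz).const_mul
    (Real.Gamma a / Real.Gamma b)).congr_deriv ?_
  rw [mul_deriv_kummerM_eq_raise (a - 1) hb z, sub_add_cancel, kummerRatioLower, kummerRatio]
  ring

theorem kummerRatio_pos {a b z : ℝ} (ha : 0 < a) (hb : 0 < b) (hz : 0 < z) :
    0 < kummerRatio b a z := by
  have h1 := Real.Gamma_pos_of_pos ha
  have h2 := Real.Gamma_pos_of_pos hb
  have h3 := kummerM_pos ha hb hz.le
  rw [kummerRatio]
  positivity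

theorem contDiffOn_kummerRatio (a : ℝ) {b : ℝ} (hb : 0 < b) (n : ℕ) :
    ContDiffOn ℝ n (kummerRatio b a) (Ioi 0) := by
  refine contDiffOn_const.mul (ContDiffOn.mul (ContDiffOn.mul ?_ ?_)
    (contDiff_kummerM a hb n).contDiffOn)
  · exact contDiff_neg.exp.contDiffOn
  · exact contDiffOn_id.rpow_const_of_ne fun x hx => (mem_Ioi.1 hx).ne'

/-! ### The change of variable `Ψ` and the partial differential equation -/

section Heston

variable {k σ T : ℝ}

theorem mul_exp_sub_one_pos (hk : k ≠ 0) {s : ℝ} (hs : 0 < s) : 0 < k * (Real.exp (k * s) - 1) := by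
  rcases hk.lt_or_gt with h | h
  · refine mul_pos_of_neg_of_neg h (sub_neg.2 (Real.exp_lt_one_iff.2 (mul_neg_of_neg_of_pos h hs)))
  · exact mul_pos h (sub_pos.2 (Real.one_lt_exp_iff.2 (mul_pos h hs)))

theorem exp_sub_one_ne_zero (hk : k ≠ 0) {t : ℝ} (ht : t < T) :
    Real.exp (k * (T - t)) - 1 ≠ 0 :=
  right_ne_zero_of_mul (mul_exp_sub_one_pos hk (sub_pos.2 ht)).ne'

theorem hestonPsi_eq_mul (v t : ℝ) : hestonPsi k σ T v t = v * hestonPsi k σ T 1 t := by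
  simp only [hestonPsi]
  ring

theorem hestonPsi_pos (hk : k ≠ 0) (hσ : σ ≠ 0) {v t : ℝ} (hv : 0 < v) (ht : t < T) :
    0 < hestonPsi k σ T v t := by
  have h := mul_exp_sub_one_pos hk (sub_pos.2 ht)
  have h2 := exp_sub_one_ne_zero hk ht
  have : hestonPsi k σ T v t = 2 * k ^ 2 * v / (σ ^ 2 * (k * (Real.exp (k * (T - t)) - 1))) := by
    rw [hestonPsi]
    field_simp
  rw [this]
  positivity

/-- Eliminating `e^{k(T-t)} = 1 + 2kv/(σ²Ψ)` leaves only `Ψ` and `v`, as the final algebraic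
identity needs. -/
theorem hasDerivAt_hestonPsi_time (hk : k ≠ 0) (hσ : σ ≠ 0) {v t : ℝ} (hv : v ≠ 0) (ht : t < T) :
    HasDerivAt (hestonPsi k σ T v)
      (hestonPsi k σ T v t * (k + σ ^ 2 * hestonPsi k σ T v t / (2 * v))) t := by
  have h2 := exp_sub_one_ne_zero hk ht
  have hd : HasDerivAt (fun t => σ ^ 2 * (Real.exp (k * (T - t)) - 1))
      (σ ^ 2 * (Real.exp (k * (T - t)) * (k * -1))) t :=
    ((((hasDerivAt_id t).const_sub T).const_mul k).exp.sub_const 1).const_mul _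
  refine ((hasDerivAt_const t (2 * k * v)).div hd (by positivity)).congr_deriv ?_
  rw [hestonPsi]
  field_simp
  ring

theorem contDiffOn_hestonPsi (hk : k ≠ 0) (hσ : σ ≠ 0) (n : ℕ) :
    ContDiffOn ℝ n (fun p : ℝ × ℝ => hestonPsi k σ T p.1 p.2) (Ioi 0 ×ˢ Iio T) := by
  refine ContDiffOn.div ?_ ?_ fun p hp => ?_
  · exact (contDiff_const.mul contDiff_fst).contDiffOn
  · exact (contDiff_const.mul ((contDiff_const.mul
      (contDiff_const.sub contDiff_snd)).exp.sub contDiff_const)).contDiffOn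
  · exact mul_ne_zero (pow_ne_zero 2 hσ) (exp_sub_one_ne_zero hk hp.2)

/-- The reciprocal of `Ψ` extends continuously to `t = T`, where it is `0`, and is positive before.
-/
theorem tendsto_hestonPsi (hk : k ≠ 0) (hσ : σ ≠ 0) {v : ℝ} (hv : 0 < v) :
    Tendsto (fun p : ℝ × ℝ => hestonPsi k σ T p.1 p.2) (𝓝[Ioi 0 ×ˢ Iio T] (v, T)) atTop := by
  have hinv : Tendsto (fun p : ℝ × ℝ => (hestonPsi k σ T p.1 p.2)⁻¹)
      (𝓝[Ioi 0 ×ˢ Iio T] (v, T)) (𝓝[>] 0) := by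
    refine tendsto_nhdsWithin_iff.2 ⟨?_, ?_⟩
    · have hc : ContinuousAt (fun p : ℝ × ℝ =>
          σ ^ 2 * (Real.exp (k * (T - p.2)) - 1) / (2 * k * p.1)) (v, T) :=
        ContinuousAt.div (by fun_prop) (by fun_prop) (by positivity)
      have h0 := hc.tendsto.mono_left (nhdsWithin_le_nhds (s := Ioi 0 ×ˢ Iio T))
      simp only [sub_self, mul_zero, Real.exp_zero, zero_div] at h0
      exact h0.congr fun p => by rw [hestonPsi, inv_div]
    · filter_upwards [self_mem_nhdsWithin] with p hp
      exact inv_pos.2 (hestonPsi_pos hk hσ hp.1 hp.2)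
  exact hinv.inv_tendsto_nhdsGT_zero.congr fun p => inv_inv _

variable {Θ μ ρ δ C : ℝ}

theorem hestonF_eq_kummerRatio (hk : k ≠ 0) (hσ : σ ≠ 0) {v t : ℝ} (hv : 0 < v) (ht : t < T) :
    hestonF k Θ μ σ ρ δ C T v t = kummerRatio (2 * hestonEta k Θ μ σ ρ δ C + 1)
      (hestonEta k Θ μ σ ρ δ C - hestonLam k Θ μ σ ρ δ + 1 / 2) (hestonPsi k σ T v t) := by
  have hz := hestonPsi_pos hk hσ hv ht
  rw [hestonF, whittakerM, kummerRatio]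
  generalize hestonPsi k σ T v t = z at *
  generalize hestonEta k Θ μ σ ρ δ C = η at *
  generalize hestonLam k Θ μ σ ρ δ = l at *
  have h1 : z ^ (2 * η + 1 - (η - l + 1 / 2)) = z ^ l * z ^ (η + 1 / 2) := by
    rw [← Real.rpow_add hz]
    congr 1
    ring
  have h2 : Real.exp (-z) = Real.exp (-z / 2) * Real.exp (-z / 2) := by
    rw [← Real.exp_add, add_halves]
  rw [h1, h2, add_comm 1 (2 * η)]
  ring

theorem kummerRatioLower_eq_whittakerM {η l z : ℝ} (hz : 0 < z) :
    kummerRatioLower (2 * η + 1) (η - l + 1 / 2) z =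
      Real.Gamma (η - l + 1 / 2) / Real.Gamma (2 * η + 1) * Real.exp (-z / 2) * z ^ l *
        whittakerM (1 + l) η z := by
  rw [whittakerM, kummerRatioLower]
  have h1 : z ^ (2 * η + 1 - (η - l + 1 / 2)) = z ^ l * z ^ (η + 1 / 2) := by
    rw [← Real.rpow_add hz]
    congr 1
    ring
  have h2 : Real.exp (-z) = Real.exp (-z / 2) * Real.exp (-z / 2) := by
    rw [← Real.exp_add, add_halves]
  rw [h1, h2, add_comm 1 (2 * η), show η - l + 1 / 2 - 1 = η - (1 + l) + 1 / 2 by ring]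
  ring

/-- If `C ≥ 0` then `η ≥ λ + 1/2`, so the argument of `Γ` is at least `1`. Both utility cases reduce
to this. -/
theorem hestonLam_lt_of_nonneg (hC : 0 ≤ C) :
    0 ≤ hestonDisc k Θ μ σ ρ δ C ∧
      0 < hestonEta k Θ μ σ ρ δ C - hestonLam k Θ μ σ ρ δ + 1 / 2 := by
  have h : (hestonLam k Θ μ σ ρ δ + 1 / 2) ^ 2 ≤ hestonDisc k Θ μ σ ρ δ C :=
    le_add_of_nonneg_right (by positivity)
  have := Real.le_sqrt_of_sq_le h
  refine ⟨(sq_nonneg _).trans h, ?_⟩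
  rw [hestonEta]
  linarith

theorem hasDerivAt_hestonF_space (hk : k ≠ 0) (hσ : σ ≠ 0) {v t : ℝ} (hv : 0 < v) (ht : t < T) :
    HasDerivAt (fun x => hestonF k Θ μ σ ρ δ C T x t)
      ((hestonEta k Θ μ σ ρ δ C + hestonLam k Θ μ σ ρ δ + 1 / 2) *
        kummerRatioLower (2 * hestonEta k Θ μ σ ρ δ C + 1)
          (hestonEta k Θ μ σ ρ δ C - hestonLam k Θ μ σ ρ δ + 1 / 2) (hestonPsi k σ T v t) / v)
      v := by
  have hη : 0 ≤ hestonEta k Θ μ σ ρ δ C := Real.sqrt_nonneg _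
  have hz := hestonPsi_pos hk hσ hv ht
  have hz1 := hestonPsi_pos hk hσ one_pos ht
  have hψ : HasDerivAt (fun x => hestonPsi k σ T x t) (hestonPsi k σ T 1 t) v := by
    rw [funext fun x => hestonPsi_eq_mul (k := k) (σ := σ) (T := T) x t]
    simpa using (hasDerivAt_id v).mul_const (hestonPsi k σ T 1 t)
  refine HasDerivAt.congr_of_eventuallyEq (((hasDerivAt_kummerRatio
    (hestonEta k Θ μ σ ρ δ C - hestonLam k Θ μ σ ρ δ + 1 / 2)
    (by linarith : 0 < 2 * hestonEta k Θ μ σ ρ δ C + 1) hz).comp v hψ).congr_deriv ?_) ?_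
  · rw [hestonPsi_eq_mul v]
    field_simp
    ring
  · filter_upwards [lt_mem_nhds hv] with x hx
    exact hestonF_eq_kummerRatio hk hσ hx ht

theorem hasDerivAt_deriv_hestonF_space (hk : k ≠ 0) (hσ : σ ≠ 0) {v t : ℝ} (hv : 0 < v)
    (ht : t < T) :
    HasDerivAt (fun y => deriv (fun x => hestonF k Θ μ σ ρ δ C T x t) y)
      ((hestonEta k Θ μ σ ρ δ C + hestonLam k Θ μ σ ρ δ + 1 / 2) / v ^ 2 *
        ((2 * hestonLam k Θ μ σ ρ δ - hestonPsi k σ T v t) *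
          kummerRatioLower (2 * hestonEta k Θ μ σ ρ δ C + 1)
            (hestonEta k Θ μ σ ρ δ C - hestonLam k Θ μ σ ρ δ + 1 / 2) (hestonPsi k σ T v t) +
        (hestonEta k Θ μ σ ρ δ C - hestonLam k Θ μ σ ρ δ - 1 / 2) *
          hestonF k Θ μ σ ρ δ C T v t)) v := by
  have hη : 0 ≤ hestonEta k Θ μ σ ρ δ C := Real.sqrt_nonneg _
  have hz := hestonPsi_pos hk hσ hv ht
  have hz1 := hestonPsi_pos hk hσ one_pos ht
  have hψ : HasDerivAt (fun x => hestonPsi k σ T x t) (hestonPsi k σ T 1 t) v := by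
    rw [funext fun x => hestonPsi_eq_mul (k := k) (σ := σ) (T := T) x t]
    simpa using (hasDerivAt_id v).mul_const (hestonPsi k σ T 1 t)
  refine HasDerivAt.congr_of_eventuallyEq (((((hasDerivAt_kummerRatioLower
    (hestonEta k Θ μ σ ρ δ C - hestonLam k Θ μ σ ρ δ + 1 / 2)
    (by linarith : 0 < 2 * hestonEta k Θ μ σ ρ δ C + 1) hz).comp v hψ).const_mul
    (hestonEta k Θ μ σ ρ δ C + hestonLam k Θ μ σ ρ δ + 1 / 2)).div (hasDerivAt_id v)
    hv.ne').congr_deriv ?_) ?_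
  · rw [hestonF_eq_kummerRatio hk hσ hv ht, hestonPsi_eq_mul v]
    simp only [Function.comp_apply, id, hestonPsi_eq_mul v]
    field_simp
    ring
  · filter_upwards [lt_mem_nhds hv] with x hx
    exact (hasDerivAt_hestonF_space hk hσ hx ht).deriv

theorem hasDerivAt_hestonF_time (hk : k ≠ 0) (hσ : σ ≠ 0) {v t : ℝ} (hv : 0 < v) (ht : t < T) :
    HasDerivAt (fun s => hestonF k Θ μ σ ρ δ C T v s)
      ((hestonEta k Θ μ σ ρ δ C + hestonLam k Θ μ σ ρ δ + 1 / 2) *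
        kummerRatioLower (2 * hestonEta k Θ μ σ ρ δ C + 1)
          (hestonEta k Θ μ σ ρ δ C - hestonLam k Θ μ σ ρ δ + 1 / 2) (hestonPsi k σ T v t) *
        (k + σ ^ 2 * hestonPsi k σ T v t / (2 * v))) t := by
  have hη : 0 ≤ hestonEta k Θ μ σ ρ δ C := Real.sqrt_nonneg _
  have hz := hestonPsi_pos hk hσ hv ht
  refine HasDerivAt.congr_of_eventuallyEq (((hasDerivAt_kummerRatio
    (hestonEta k Θ μ σ ρ δ C - hestonLam k Θ μ σ ρ δ + 1 / 2)
    (by linarith : 0 < 2 * hestonEta k Θ μ σ ρ δ C + 1) hz).comp t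
    (hasDerivAt_hestonPsi_time hk hσ hv.ne' ht)).congr_deriv ?_) ?_
  · field_simp
    ring
  · filter_upwards [gt_mem_nhds ht] with s hs
    exact hestonF_eq_kummerRatio hk hσ hv hs

theorem isHestonSolution_hestonF (hk : k ≠ 0) (hσ : σ ≠ 0)
    (hdisc : 0 ≤ hestonDisc k Θ μ σ ρ δ C)
    (hpos : 0 < hestonEta k Θ μ σ ρ δ C - hestonLam k Θ μ σ ρ δ + 1 / 2) :
    IsHestonSolution k Θ μ σ ρ δ C T (hestonF k Θ μ σ ρ δ C T) := by
  have hη : 0 ≤ hestonEta k Θ μ σ ρ δ C := Real.sqrt_nonneg _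
  have hb : 0 < 2 * hestonEta k Θ μ σ ρ δ C + 1 := by linarith
  refine ⟨?_, fun v t hv ht => ?_, fun v hv => ?_⟩
  · refine ((contDiffOn_kummerRatio
      (hestonEta k Θ μ σ ρ δ C - hestonLam k Θ μ σ ρ δ + 1 / 2) hb 2).comp (contDiffOn_hestonPsi hk hσ 2)
      fun p hp => hestonPsi_pos hk hσ hp.1 hp.2).congr fun p hp => ?_
    exact hestonF_eq_kummerRatio hk hσ hp.1 hp.2
  · rw [(hasDerivAt_deriv_hestonF_space hk hσ hv ht).deriv,
      (hasDerivAt_hestonF_space hk hσ hv ht).deriv, (hasDerivAt_hestonF_time hk hσ hv ht).deriv]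
    -- Splitting the quotient as `x / ρ / σ` avoids cancelling `ρ`, so `ρ = 0` needs no separate
    -- case.
    have hdrift : k * Θ - (1 - δ) / ρ * μ * σ = -(σ ^ 2 * hestonLam k Θ μ σ ρ δ) := by
      rw [hestonLam, div_mul_eq_div_div]
      field_simp
      ring
    -- The difference of squares factors as `(η + λ + 1/2)(η - λ - 1/2)`, the coefficient of `f` in
    -- `v² f_vv`.
    have hC : C = σ ^ 2 / 2 * (hestonEta k Θ μ σ ρ δ C ^ 2 -
        (hestonLam k Θ μ σ ρ δ + 1 / 2) ^ 2) := by
      rw [hestonEta, Real.sq_sqrt hdisc, hestonDisc]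
      field_simp
      ring
    -- Only the term `C / v * f` is to be replaced: `η` itself depends on `C`.
    have hCv := congrArg (fun x => x / v * hestonF k Θ μ σ ρ δ C T v t) hC
    rw [hdrift, hCv]
    field_simp
    ring
  · refine ((tendsto_kummerRatio hpos hb).comp (tendsto_hestonPsi hk hσ hv)).congr' ?_
    filter_upwards [self_mem_nhdsWithin] with p hp
    exact (hestonF_eq_kummerRatio hk hσ hp.1 hp.2).symm

end Heston

theorem mainTheorem3 (k Θ μ σ ρ δ C T : ℝ) (hk : k ≠ 0) (hσ : σ ≠ 0)
    (hδC :
      -- power utility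
      (|ρ| ≤ 1 ∧ ∃ γ : ℝ, γ < 0 ∧ δ = 1 + ρ ^ 2 * (γ / (1 - γ)) ∧
        C = -(γ / (1 - γ)) * (μ ^ 2 / 2) * δ) ∨
      -- exponential utility
      (|ρ| ≤ 1 ∧ δ = 1 - ρ ^ 2 ∧ C = μ ^ 2 / 2 * δ) ∨
      -- any other constants for which `η` is real and the argument of `Γ` is positive
      (0 ≤ hestonDisc k Θ μ σ ρ δ C ∧
        0 < hestonEta k Θ μ σ ρ δ C - hestonLam k Θ μ σ ρ δ + 1 / 2)) :
    IsHestonSolution k Θ μ σ ρ δ C T (hestonF k Θ μ σ ρ δ C T) ∧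
    ∀ v t : ℝ, 0 < v → t < T →
      hestonF k Θ μ σ ρ δ C T v t ≠ 0 ∧
      whittakerM (hestonLam k Θ μ σ ρ δ) (hestonEta k Θ μ σ ρ δ C) (hestonPsi k σ T v t) ≠ 0 ∧
      deriv (fun x => hestonF k Θ μ σ ρ δ C T x t) v / hestonF k Θ μ σ ρ δ C T v t =
        (hestonEta k Θ μ σ ρ δ C + hestonLam k Θ μ σ ρ δ + 1 / 2) / v *
          (whittakerM (1 + hestonLam k Θ μ σ ρ δ) (hestonEta k Θ μ σ ρ δ C)
              (hestonPsi k σ T v t) /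
            whittakerM (hestonLam k Θ μ σ ρ δ) (hestonEta k Θ μ σ ρ δ C)
              (hestonPsi k σ T v t)) := by
  have hcond : 0 ≤ hestonDisc k Θ μ σ ρ δ C ∧
      0 < hestonEta k Θ μ σ ρ δ C - hestonLam k Θ μ σ ρ δ + 1 / 2 := by
    rcases hδC with ⟨hρ, γ, hγ, hδ, hC⟩ | ⟨hρ, hδ, hC⟩ | h
    · have hρ2 : ρ ^ 2 ≤ 1 := (sq_le_one_iff_abs_le_one ρ).2 hρ
      have h1 : γ / (1 - γ) ≤ 0 := div_nonpos_of_nonpos_of_nonneg hγ.le (by linarith)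
      -- Together with `ρ² ≤ 1` this yields `δ ≥ 0`, hence `C ≥ 0`.
      have h2 : -1 ≤ γ / (1 - γ) := by
        rw [le_div_iff₀ (by linarith)]
        linarith
      have hδ0 : 0 ≤ δ := by
        rw [hδ]
        nlinarith [sq_nonneg ρ]
      refine hestonLam_lt_of_nonneg ?_
      rw [hC]
      exact mul_nonneg (mul_nonneg (neg_nonneg.2 h1) (by positivity)) hδ0
    · have hρ2 : ρ ^ 2 ≤ 1 := (sq_le_one_iff_abs_le_one ρ).2 hρ
      refine hestonLam_lt_of_nonneg ?_
      rw [hC]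
      exact mul_nonneg (by positivity) (by linarith)
    · exact h
  obtain ⟨hdisc, hpos⟩ := hcond
  refine ⟨isHestonSolution_hestonF hk hσ hdisc hpos, fun v t hv ht => ?_⟩
  have hη : 0 ≤ hestonEta k Θ μ σ ρ δ C := Real.sqrt_nonneg _
  have hz := hestonPsi_pos hk hσ hv ht
  have hF : hestonF k Θ μ σ ρ δ C T v t ≠ 0 := by
    rw [hestonF_eq_kummerRatio hk hσ hv ht]
    exact (kummerRatio_pos hpos (by linarith) hz).ne'
  refine ⟨hF, right_ne_zero_of_mul hF, ?_⟩
  rw [(hasDerivAt_hestonF_space hk hσ hv ht).deriv, kummerRatioLower_eq_whittakerM hz, hestonF,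
    mul_div_right_comm, mul_div_assoc,
    mul_div_mul_left _ _ (left_ne_zero_of_mul hF)]
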